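/- Let $R$ be a one-dimensional noetherian Cohen–Macaulay commutative ring. Let $\mathrm{cm}\,R$ be the category of maximal Cohen–Macaulay $R$-modules, i.e. of the finitely generated $R$-modules $M$ such that, for every prime ideal $\mathfrak p$, either $M_{\mathfrak p}=0$ or $\operatorname{depth}_{R_{\mathfrak p}} M_{\mathfrak p}=\dim R_{\mathfrak p}$. A Serre subcategory of $\mathrm{cm}\,R$ is a full additive subcategory $\mathcal S$ of $\mathrm{cm}\,R$, closed under isomorphisms, such that for every exact sequence $0\to L\to M\to N\to 0$ of $R$-modules with $L,M,N\in\mathrm{cm}\,R$ one has $M\in\mathcal S$ if and only if $L\in\mathcal S$ and $N\in\mathcal S$. Then there is a bijection between the set of Serre subcategories of $\mathrm{cm}\,R$ and the set of subsets of the set $\operatorname{Min} R$ of minimal prime ideals of $R$. Explicitly, the assignments $\mathcal S\mapsto \bigcup_{M\in\mathcal S}\operatorname{Ass}_R M$ and $\Phi\mapsto\{M\in\mathrm{cm}\,R : \operatorname{Ass}_R M\subseteq\Phi\}$ are mutually inverse bijections between these two sets. -/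

import Mathlib

universe u

open CategoryTheory

/-- The depth of a module over a local ring: the supremum of the lengths of the `M`-regular
sequences contained in the maximal ideal. -/
noncomputable def localDepth (A : Type*) [CommRing A] [IsLocalRing A]
    (M : Type*) [AddCommGroup M] [Module A M] : ℕ∞ :=
  ⨆ (rs : List A) (_ : RingTheory.Sequence.IsRegular M rs)
    (_ : ∀ r ∈ rs, r ∈ IsLocalRing.maximalIdeal A), (rs.length : ℕ∞)

/-- A module `M` over a (noetherian) local ring is Cohen–Macaulay if `M = 0` or
`depth M = dim M`. -/
def IsLocalCM (A : Type*) [CommRing A] [IsLocalRing A]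
    (M : Type*) [AddCommGroup M] [Module A M] : Prop :=
  Subsingleton M ∨ (localDepth A M : WithBot ℕ∞) = Module.supportDim A M

/-- A module `M` over a (noetherian) local ring `A` is maximal Cohen–Macaulay if `M = 0` or
`depth M = dim A`. -/
def IsLocalMaximalCM (A : Type*) [CommRing A] [IsLocalRing A]
    (M : Type*) [AddCommGroup M] [Module A M] : Prop :=
  Subsingleton M ∨ (localDepth A M : WithBot ℕ∞) = ringKrullDim A

/-- A (noetherian) commutative ring `R` is Cohen–Macaulay if for every prime `p` the local ring
`R_p` is Cohen–Macaulay as a module over itself. -/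
def IsCMRing (R : Type*) [CommRing R] : Prop :=
  ∀ p : PrimeSpectrum R,
    IsLocalCM (Localization.AtPrime p.asIdeal) (Localization.AtPrime p.asIdeal)

/-- The category `cm R`: the finitely generated `R`-modules `M` such that `M_p` is a maximal
Cohen–Macaulay `R_p`-module for every prime `p`, as a full subcategory of all `R`-modules. -/
def cm (R : Type u) [CommRing R] : ObjectProperty (ModuleCat.{u} R) := fun M =>
  Module.Finite R M ∧ ∀ p : PrimeSpectrum R,
    IsLocalMaximalCM (Localization.AtPrime p.asIdeal)
      (LocalizedModule p.asIdeal.primeCompl M)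

/-- `S` is a Serre subcategory of the (extension-closed) subcategory `X` of an abelian category:
an additive full subcategory of `X`, closed under isomorphisms, such that for every conflation
`0 ⟶ X₁ ⟶ X₂ ⟶ X₃ ⟶ 0` of `X` one has `X₂ ∈ S` if and only if `X₁ ∈ S` and `X₃ ∈ S`. -/
structure IsSerreSubcategory {C : Type*} [Category C] [Abelian C]
    (X S : ObjectProperty C) : Prop where
  le : S ≤ X
  closedUnderIso : S.IsClosedUnderIsomorphisms
  containsZero : S.ContainsZero
  biprod_mem : ∀ M N : C, S M → S N → S (M ⊞ N)
  conflation_iff : ∀ T : ShortComplex C, T.ShortExact → X T.X₁ → X T.X₂ → X T.X₃ →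
    (S T.X₂ ↔ S T.X₁ ∧ S T.X₃)

/-- `Ass S`: the union of the sets of associated primes of the modules in `S`. -/
def assOf {R : Type u} [CommRing R] (S : ObjectProperty (ModuleCat.{u} R)) : Set (Ideal R) :=
  {p | ∃ M : ModuleCat.{u} R, S M ∧ p ∈ associatedPrimes R M}

section Depth

variable {A : Type*} [CommRing A] [IsLocalRing A] {M : Type*} [AddCommGroup M] [Module A M]

/-! In dimension at most one, a finitely generated module is maximal Cohen–Macaulay iff its
associated primes are minimal (`cm_iff`), so `cm R` is closed under submodules and extensions. For
minimal `p`, `R ⧸ p` realises `{p}`, so `Φ` is recovered from its subcategory. The converse,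
`mem_of_associatedPrimes_subset`, grows a submodule in `S` until it is all of `M`. Quotients may
leave `cm R`, so fibre products stand in for them. -/

lemma length_le_localDepth {rs : List A} (h : RingTheory.Sequence.IsRegular M rs)
    (hmem : ∀ r ∈ rs, r ∈ IsLocalRing.maximalIdeal A) : (rs.length : ℕ∞) ≤ localDepth A M :=
  le_iSup_of_le rs (le_iSup_of_le h (le_iSup_of_le hmem le_rfl))

lemma localDepth_le_ringKrullDim [IsNoetherianRing A] [Module.Finite A M] [Nontrivial M] :
    (localDepth A M : WithBot ℕ∞) ≤ ringKrullDim A := by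
  obtain ⟨d, hd⟩ := WithBot.ne_bot_iff_exists.mp (ringKrullDim_ne_bot (R := A))
  rw [← hd, WithBot.coe_le_coe]
  refine iSup_le fun rs => iSup_le fun hrs => iSup_le fun _ => ?_
  rw [← WithBot.coe_le_coe, hd]
  have hlen := Module.supportDim_add_length_eq_supportDim_of_isRegular rs hrs
  -- Nontriviality keeps the dimension of the quotient away from `⊥`, hence nonnegative.
  have : Nontrivial (M ⧸ Ideal.ofList rs • (⊤ : Submodule A M)) :=
    Submodule.Quotient.nontrivial_iff.mpr hrs.top_ne_smul.symm
  obtain ⟨e, he⟩ := WithBot.ne_bot_iff_exists.mp (Module.supportDim_ne_bot_of_nontrivial A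
    (M ⧸ Ideal.ofList rs • (⊤ : Submodule A M)))
  refine le_trans ?_ (Module.supportDim_le_ringKrullDim A M)
  rw [← hlen, ← he]
  exact WithBot.coe_le_coe.mpr (le_add_self : (rs.length : ℕ∞) ≤ e + rs.length)

lemma localDepth_eq_zero_of_maximalIdeal_mem_associatedPrimes [IsNoetherianRing A]
    (h : IsLocalRing.maximalIdeal A ∈ associatedPrimes A M) : localDepth A M = 0 := by
  refine le_antisymm (iSup_le fun rs => iSup_le fun hrs => iSup_le fun hmem => ?_) bot_le
  cases rs with
  | nil => simp
  | cons r rs =>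
    have hr : r ∈ ⋃ p ∈ associatedPrimes A M, (p : Set A) :=
      Set.mem_biUnion h (hmem r (by simp))
    rw [biUnion_associatedPrimes_eq_compl_regular] at hr
    exact absurd ((RingTheory.Sequence.isRegular_cons_iff M r rs).mp hrs).1 hr

end Depth

/-! ### Maximal Cohen–Macaulay modules via associated primes -/

section MaximalCohenMacaulay

variable {R : Type u} [CommRing R] [IsNoetherianRing R]

/-- Over a ring of dimension at most one, maximal Cohen–Macaulay modules are the finitely generated
modules all of whose associated primes are minimal. -/
lemma cm_iff (hdim : ringKrullDim R ≤ 1) (M : ModuleCat.{u} R) :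
    cm R M ↔ Module.Finite R M ∧ associatedPrimes R M ⊆ minimalPrimes R := by
  refine and_congr_right fun hfin => ⟨fun h p hp => ?_, fun h p => ?_⟩
  · have := hp.isPrime
    have hp' := Module.associatedPrimes.mem_associatedPrimes_atPrime_of_mem_associatedPrimes hp
    rcases h ⟨p, hp.isPrime⟩ with hs | hd
    · have hs' : Subsingleton (LocalizedModule.AtPrime p M) := hs
      rw [associatedPrimes.eq_empty_of_subsingleton] at hp'
      exact hp'.elim
    · have hd' : (localDepth (Localization.AtPrime p) (LocalizedModule.AtPrime p M) : WithBot ℕ∞)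
        = ringKrullDim (Localization.AtPrime p) := hd
      rw [localDepth_eq_zero_of_maximalIdeal_mem_associatedPrimes hp',
        IsLocalization.AtPrime.ringKrullDim_eq_height p, WithBot.coe_inj] at hd'
      exact Ideal.height_eq_zero_iff.mp hd'.symm
  · obtain ⟨p, hp⟩ := p
    change IsLocalMaximalCM (Localization.AtPrime p) (LocalizedModule p.primeCompl M)
    refine or_iff_not_imp_left.mpr fun hs => ?_
    rw [not_subsingleton_iff_nontrivial] at hs
    have : Module.Finite (Localization.AtPrime p) (LocalizedModule p.primeCompl M) :=
      Module.Finite.of_isLocalizedModule p.primeCompl (LocalizedModule.mkLinearMap p.primeCompl M)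
    refine le_antisymm localDepth_le_ringKrullDim ?_
    rw [IsLocalization.AtPrime.ringKrullDim_eq_height p, WithBot.coe_le_coe]
    by_cases hmin : p ∈ minimalPrimes R
    · simp [Ideal.height_eq_zero_iff.mpr hmin]
    have hle : p.height ≤ 1 := by
      have := (Ideal.height_le_ringKrullDim_of_isPrime (I := p)).trans hdim
      exact_mod_cast this
    -- Prime avoidance: a nonminimal `p` lies in no associated prime, so it contains an `M`-regular
    -- element, and height at most one needs no more.
    have hnot : ¬ ((p : Set R) ⊆ ⋃ q ∈ associatedPrimes R M, (q : Set R)) := by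
      intro hsub
      obtain ⟨q, hq, hpq⟩ := (Ideal.subset_union_prime_finite (associatedPrimes.finite R M)
        (f := id) p p (fun q hq _ _ => hq.isPrime)).mp hsub
      have := (h hq).2 ⟨hp, bot_le⟩ hpq
      exact hmin (le_antisymm hpq this ▸ h hq)
    rw [biUnion_associatedPrimes_eq_compl_regular, Set.not_subset] at hnot
    obtain ⟨r, hrp, hr⟩ := hnot
    have hreg := ((RingTheory.Sequence.isWeaklyRegular_singleton_iff M r).mpr
      (not_not.mp hr)).isRegular_of_isLocalizedModule_of_mem (Localization.AtPrime p) p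
      (LocalizedModule.mkLinearMap p.primeCompl M) (by simpa using hrp)
    refine hle.trans (le_trans ?_ (length_le_localDepth hreg ?_))
    · simp
    · simp only [List.map_cons, List.map_nil, List.mem_singleton, forall_eq]
      exact (IsLocalization.AtPrime.to_map_mem_maximal_iff _ p r).mpr hrp

lemma cm_of_injective (hdim : ringKrullDim R ≤ 1) {M N : ModuleCat.{u} R} (f : M →ₗ[R] N)
    (hf : Function.Injective f) (hN : cm R N) : cm R M := by
  rw [cm_iff hdim] at hN ⊢
  have := hN.1
  exact ⟨Module.Finite.of_injective f hf, (associatedPrimes.subset_of_injective hf).trans hN.2⟩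

lemma cm_prod (hdim : ringKrullDim R ≤ 1) {M N : ModuleCat.{u} R} (hM : cm R M) (hN : cm R N) :
    cm R (ModuleCat.of R (M × N)) := by
  rw [cm_iff hdim] at hM hN ⊢
  have := hM.1
  have := hN.1
  refine ⟨inferInstanceAs (Module.Finite R (M × N)), ?_⟩
  change associatedPrimes R (M × N) ⊆ _
  rw [associatedPrimes.prod]
  exact Set.union_subset hM.2 hN.2

lemma cm_quotient_minimalPrime (hdim : ringKrullDim R ≤ 1) {p : Ideal R}
    (hp : p ∈ minimalPrimes R) : cm R (ModuleCat.of R (R ⧸ p)) := by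
  have := hp.1.1
  rw [cm_iff hdim]
  refine ⟨inferInstanceAs (Module.Finite R (R ⧸ p)), ?_⟩
  change associatedPrimes R (R ⧸ p) ⊆ _
  rw [associatedPrimes.eq_singleton_of_isPrimary hp.1.1.isPrimary, hp.1.1.radical]
  simpa using hp

/-- The associated primes of a quotient of `M` that are minimal primes of the ring are associated
primes of `M`. -/
lemma mem_associatedPrimes_of_surjective {M N : Type*} [AddCommGroup M] [Module R M]
    [AddCommGroup N] [Module R N] [Module.Finite R M] (f : M →ₗ[R] N)
    (hf : Function.Surjective f) {p : Ideal R} (hp : p ∈ associatedPrimes R N)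
    (hmin : p ∈ minimalPrimes R) : p ∈ associatedPrimes R M := by
  -- A minimal prime of `R` containing the annihilator of `M` is minimal over it.
  refine Module.associatedPrimes.minimalPrimes_annihilator_subset_associatedPrimes R M
    ⟨⟨hp.isPrime, (f.annihilator_le_of_surjective hf).trans ?_⟩,
      fun q hq hqp => hmin.2 ⟨hq.1, bot_le⟩ hqp⟩
  simpa [Submodule.annihilator_top] using hp.annihilator_le

end MaximalCohenMacaulay

/-! ### Serre subcategories and sets of minimal primes -/

section Serre

variable {R : Type u} [CommRing R] [IsNoetherianRing R]

/-- The maximal Cohen–Macaulay modules whose associated primes lie in `Φ`. -/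
def cmSupportedOn (R : Type u) [CommRing R] (Φ : Set (Ideal R)) :
    ObjectProperty (ModuleCat.{u} R) :=
  fun M => cm R M ∧ associatedPrimes R M ⊆ Φ

lemma isSerreSubcategory_cmSupportedOn (hdim : ringKrullDim R ≤ 1) (Φ : Set (Ideal R)) :
    IsSerreSubcategory (cm R) (cmSupportedOn R Φ) where
  le _ h := h.1
  closedUnderIso := ⟨fun e h => ⟨cm_of_injective hdim e.symm.toLinearEquiv.toLinearMap
    e.symm.toLinearEquiv.injective h.1,
    (LinearEquiv.AssociatedPrimes.eq e.toLinearEquiv).symm.le.trans h.2⟩⟩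
  containsZero := by
    have h : associatedPrimes R (ModuleCat.of R PUnit.{u + 1}) = ∅ :=
      associatedPrimes.eq_empty_of_subsingleton (M := PUnit.{u + 1})
    refine ⟨⟨ModuleCat.of R PUnit, ModuleCat.isZero_of_subsingleton _,
      (cm_iff hdim _).mpr ⟨inferInstanceAs (Module.Finite R PUnit.{u + 1}), ?_⟩, ?_⟩⟩ <;> simp [h]
  biprod_mem M N hM hN := by
    let e := (ModuleCat.biprodIsoProd M N).toLinearEquiv
    refine ⟨cm_of_injective hdim e.toLinearMap e.injective (cm_prod hdim hM.1 hN.1), ?_⟩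
    rw [LinearEquiv.AssociatedPrimes.eq e]
    change associatedPrimes R (M × N) ⊆ _
    rw [associatedPrimes.prod]
    exact Set.union_subset hM.2 hN.2
  conflation_iff T hT h₁ h₂ h₃ := by
    have hinj : Function.Injective T.f.hom := hT.moduleCat_injective_f
    have hsurj : Function.Surjective T.g.hom := hT.moduleCat_surjective_g
    have hexact : Function.Exact T.f.hom T.g.hom :=
      (ShortComplex.ShortExact.moduleCat_exact_iff_function_exact _).mp hT.exact
    have := h₂.1
    refine ⟨fun h => ⟨⟨h₁, (associatedPrimes.subset_of_injective hinj).trans h.2⟩, h₃,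
      fun p hp => h.2 ?_⟩, fun h => ⟨h₂, (associatedPrimes.subset_union_of_exact hinj hexact).trans
        (Set.union_subset h.1.2 h.2.2)⟩⟩
    exact mem_associatedPrimes_of_surjective T.g.hom hsurj hp (((cm_iff hdim _).mp h₃).2 hp)

namespace IsSerreSubcategory

variable {S : ObjectProperty (ModuleCat.{u} R)}

/-- If `N` and `P` surject onto the same module, with `N` and the kernel of the second map in
`S`, then `P` is in `S`: compare both with the fibre product. -/
lemma mem_of_surjective_of_ker (hdim : ringKrullDim R ≤ 1) (hS : IsSerreSubcategory (cm R) S)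
    {N P : ModuleCat.{u} R} {T : Type*} [AddCommGroup T] [Module R T]
    (f : N →ₗ[R] T) (g : P →ₗ[R] T) (hf : Function.Surjective f) (hg : Function.Surjective g)
    (hP : cm R P) (hN : S N) (hker : S (ModuleCat.of R (LinearMap.ker g))) : S P := by
  let E : Submodule R (N × P) :=
    LinearMap.ker (f ∘ₗ LinearMap.fst R N P - g ∘ₗ LinearMap.snd R N P)
  have hE (x : N × P) : x ∈ E ↔ f x.1 = g x.2 := by simp [E, sub_eq_zero]
  have hcmE : cm R (ModuleCat.of R E) :=
    cm_of_injective hdim (N := ModuleCat.of R (N × P)) E.subtype E.injective_subtype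
      (cm_prod hdim (hS.le _ hN) hP)
  let i : LinearMap.ker g →ₗ[R] E :=
    (LinearMap.inr R N P ∘ₗ (LinearMap.ker g).subtype).codRestrict E
      (fun x => by simp [hE])
  let π₁ : E →ₗ[R] N := LinearMap.fst R N P ∘ₗ E.subtype
  let π₂ : E →ₗ[R] P := LinearMap.snd R N P ∘ₗ E.subtype
  have hπ₁ : Function.Surjective π₁ := fun n => by
    obtain ⟨x, hx⟩ := hg (f n)
    exact ⟨⟨(n, x), (hE _).mpr hx.symm⟩, rfl⟩
  have hπ₂ : Function.Surjective π₂ := fun x => by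
    obtain ⟨n, hn⟩ := hf (g x)
    exact ⟨⟨(n, x), (hE _).mpr hn⟩, rfl⟩
  have hi : Function.Injective i := fun x y h =>
    Subtype.ext (congrArg (fun e : E => e.1.2) h)
  have hexact : Function.Exact i π₁ := by
    rintro ⟨⟨n, x⟩, h⟩
    rw [hE] at h
    refine ⟨fun h0 => ?_, ?_⟩
    · have hn : n = 0 := h0
      subst hn
      exact ⟨⟨x, by simpa using h.symm⟩, rfl⟩
    · rintro ⟨y, hy⟩
      rw [← hy]
      rfl
  -- `E` is an extension of `N` by `ker g`, and it also surjects onto `P` with kernel in `cm R`.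
  have hSE : S (ModuleCat.of R E) :=
    (hS.conflation_iff _ (ModuleCat.shortComplex_shortExact
      (ModuleCat.shortComplexOfCompEqZero i π₁ (by ext; rfl)) hexact hi hπ₁)
      (hS.le _ hker) hcmE (hS.le _ hN)).mpr ⟨hker, hN⟩
  exact ((hS.conflation_iff _ (LinearMap.shortExact_shortComplexKer hπ₂)
    (cm_of_injective hdim (N := ModuleCat.of R E) _ (LinearMap.ker π₂).injective_subtype hcmE)
    hcmE hP).mp hSE).2

/-- Were a maximal submodule `Q` in `S` proper, a nonzero map from some `N` in `S` to `M ⧸ Q` would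
have an image whose preimage in `M` is larger and still in `S`. -/
lemma mem_of_associatedPrimes_subset (hdim : ringKrullDim R ≤ 1)
    (hS : IsSerreSubcategory (cm R) S) {M : ModuleCat.{u} R} (hM : cm R M)
    (hass : associatedPrimes R M ⊆ assOf S) : S M := by
  have := hS.closedUnderIso
  have := hM.1
  have hne : {Q : Submodule R M | S (ModuleCat.of R Q)}.Nonempty := by
    obtain ⟨Z, hZ, hSZ⟩ := hS.containsZero.exists_zero
    exact ⟨⊥, S.prop_of_iso (hZ.iso (ModuleCat.isZero_of_subsingleton
      (ModuleCat.of R (⊥ : Submodule R M)))) hSZ⟩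
  obtain ⟨Q, hQ, hmax⟩ := set_has_maximal_iff_noetherian.mpr
    (inferInstanceAs (IsNoetherian R M)) _ hne
  by_cases htop : Q = ⊤
  · subst htop
    exact S.prop_of_iso (LinearEquiv.toModuleIso Submodule.topEquiv) hQ
  exfalso
  have hnt : Nontrivial (M ⧸ Q) := Submodule.Quotient.nontrivial_iff.mpr htop
  obtain ⟨p, hp⟩ := associatedPrimes.nonempty R (M ⧸ Q)
  have := hp.isPrime
  have hpM : Module.annihilator R M ≤ p := by
    refine (Q.mkQ.annihilator_le_of_surjective Q.mkQ_surjective).trans ?_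
    simpa [Submodule.annihilator_top] using hp.annihilator_le
  obtain ⟨q, hq, hqp⟩ := Ideal.exists_minimalPrimes_le hpM
  obtain ⟨N, hN, hqN⟩ := hass
    (Module.associatedPrimes.minimalPrimes_annihilator_subset_associatedPrimes R M hq)
  have := (hS.le _ hN).1
  -- The annihilator of `N` lies in `q ≤ p`, and every element of `p` is a zero divisor on `M ⧸ Q`.
  have hhom : ¬ Subsingleton (N →ₗ[R] M ⧸ Q) := by
    rw [IsSMulRegular.subsingleton_linearMap_iff]
    rintro ⟨r, hr, hreg⟩
    have hrp : r ∈ ⋃ p ∈ associatedPrimes R (M ⧸ Q), (p : Set R) := by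
      refine Set.mem_biUnion hp (hqp (hqN.annihilator_le ?_))
      rwa [Submodule.annihilator_top]
    rw [biUnion_associatedPrimes_eq_compl_regular] at hrp
    exact hrp hreg
  rw [not_subsingleton_iff_nontrivial] at hhom
  obtain ⟨f, hf⟩ := exists_ne (0 : N →ₗ[R] M ⧸ Q)
  let P : Submodule R M := (LinearMap.range f).comap Q.mkQ
  have hQP : Q ≤ P := fun x hx => by
    simp [P, (Submodule.Quotient.mk_eq_zero Q).mpr hx]
  have hlt : Q < P := by
    refine lt_of_le_of_ne hQP fun h => hf ?_
    ext n
    obtain ⟨m, hm⟩ := Q.mkQ_surjective (f n)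
    have hmP : m ∈ P := ⟨n, hm.symm⟩
    rw [← h] at hmP
    rw [← hm]
    simpa using hmP
  let g : P →ₗ[R] LinearMap.range f := Q.mkQ.restrict fun _ hx => hx
  have hg : Function.Surjective g := by
    rintro ⟨t, ht⟩
    obtain ⟨m, rfl⟩ := Q.mkQ_surjective t
    exact ⟨⟨m, ht⟩, rfl⟩
  have hkerg : LinearMap.ker g = Q.submoduleOf P := by
    ext x
    simp [g, Submodule.submoduleOf, Subtype.ext_iff]
  refine hmax P ?_ hlt
  refine hS.mem_of_surjective_of_ker hdim (P := ModuleCat.of R P) f.rangeRestrict g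
    f.surjective_rangeRestrict hg
    (cm_of_injective hdim (N := M) P.subtype P.injective_subtype hM) hN ?_
  exact S.prop_of_iso (LinearEquiv.toModuleIso ((LinearEquiv.ofEq _ _ hkerg).trans
    (Submodule.submoduleOfEquivOfLe hQP))).symm hQ

lemma assOf_subset_minimalPrimes (hdim : ringKrullDim R ≤ 1)
    (hS : IsSerreSubcategory (cm R) S) : assOf S ⊆ minimalPrimes R := by
  rintro p ⟨M, hM, hp⟩
  exact ((cm_iff hdim M).mp (hS.le _ hM)).2 hp

lemma cmSupportedOn_assOf (hdim : ringKrullDim R ≤ 1) (hS : IsSerreSubcategory (cm R) S) :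
    cmSupportedOn R (assOf S) = S := by
  ext M
  exact ⟨fun h => hS.mem_of_associatedPrimes_subset hdim h.1 h.2,
    fun h => ⟨hS.le _ h, fun p hp => ⟨M, h, hp⟩⟩⟩

end IsSerreSubcategory

lemma assOf_cmSupportedOn (hdim : ringKrullDim R ≤ 1) {Φ : Set (Ideal R)}
    (hΦ : Φ ⊆ minimalPrimes R) : assOf (cmSupportedOn R Φ) = Φ := by
  ext p
  refine ⟨fun ⟨M, hM, hp⟩ => hM.2 hp, fun hp => ?_⟩
  have hprime : p.IsPrime := (hΦ hp).1.1
  have hass : associatedPrimes R (R ⧸ p) = {p} := by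
    rw [associatedPrimes.eq_singleton_of_isPrimary hprime.isPrimary, hprime.radical]
  refine ⟨ModuleCat.of R (R ⧸ p), ⟨cm_quotient_minimalPrime hdim (hΦ hp), ?_⟩, ?_⟩
  · change associatedPrimes R (R ⧸ p) ⊆ Φ
    simpa [hass] using hp
  · change p ∈ associatedPrimes R (R ⧸ p)
    simp [hass]

end Serre

theorem theoremF (R : Type u) [CommRing R] [IsNoetherianRing R]
    (hdim : ringKrullDim R = 1) (hCM : IsCMRing R) :
    ∃ e : {S : ObjectProperty (ModuleCat.{u} R) // IsSerreSubcategory (cm R) S} ≃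
        {Φ : Set (Ideal R) // Φ ⊆ minimalPrimes R},
      (∀ S, (e S : Set (Ideal R)) = assOf S.1) ∧
      (∀ (Φ : {Φ : Set (Ideal R) // Φ ⊆ minimalPrimes R}) (M : ModuleCat.{u} R),
        (e.symm Φ).1 M ↔ cm R M ∧ associatedPrimes R M ⊆ Φ.1) :=
  ⟨{ toFun := fun S => ⟨assOf S.1, S.2.assOf_subset_minimalPrimes hdim.le⟩
     invFun := fun Φ => ⟨cmSupportedOn R Φ.1, isSerreSubcategory_cmSupportedOn hdim.le Φ.1⟩
     left_inv := fun S => Subtype.ext (S.2.cmSupportedOn_assOf hdim.le)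
     right_inv := fun Φ => Subtype.ext (assOf_cmSupportedOn hdim.le Φ.2) },
    fun _ => rfl, fun _ _ => Iff.rfl⟩
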